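/- Let $R$ be a commutative noetherian ring (not necessarily local) which is Gorenstein, i.e. for every maximal ideal $\mathfrak m$ of $R$ the local ring $R_{\mathfrak m}$ has finite injective dimension as a module over itself. Let $M$ be a finitely generated $R$-module. An $R$-module $N$ is called reflexive if the natural map $N\to N^{\ast\ast}$ is bijective, where $N^{\ast}=\operatorname{Hom}_R(N,R)$. Then the following hold. (i) If $\operatorname{Ext}^1_R(M,M)=0$ and $\operatorname{Hom}_R(M,M)$ is reflexive, then $M$ is reflexive. (ii) If $M$ is reflexive, then $\operatorname{Hom}_R(M,M)$ is reflexive. -/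

import Mathlib

open CategoryTheory

universe u v

/-- A Gorenstein local ring: a commutative noetherian local ring whose injective dimension
as a module over itself is finite. -/
class IsGorensteinLocalRing (R : Type*) [CommRing R] : Prop
    extends IsLocalRing R, IsNoetherianRing R where
  exists_hasInjectiveDimensionLE : ∃ n : ℕ, HasInjectiveDimensionLE (ModuleCat.of R R) n

/-- A Gorenstein ring: a commutative noetherian ring all of whose localizations at maximal ideals
are Gorenstein local rings. -/
class IsGorensteinRing (R : Type*) [CommRing R] : Prop
    extends IsNoetherianRing R where
  isGorensteinLocalRing_localization : ∀ (m : Ideal R) [m.IsMaximal],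
    IsGorensteinLocalRing (Localization.AtPrime m)

/-!
Reflexivity over a Gorenstein ring `R` is governed by depth: a finitely generated module `N` is
reflexive as soon as `depth N_p ≥ min (2, depth R_p)` for every prime `p` with `N_p ≠ 0`. The depth
conditions appear as the absence of socle elements (elements killed by the maximal ideal) in `N_p`
and in `N_p ⧸ x N_p`, where `x` is regular on `R_p`.

The criterion is `injective_eval_of_isSocleFree` together with `isReflexive_of_isSocleFreeMod`.
Localizing at an associated prime of the kernel or of the cokernel of `N → N**` produces a socle
element there, over a local ring `A` of finite injective dimension. By the argument of Bass
(`subsingleton_ext_of_socle`), `A` is self-injective if its depth is zero, and biduality is then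
bijective; if the depth is one, `A` has injective dimension at most one, so that
`Ext¹(N**, A) = 0`, and the cokernel has no socle (`mem_range_eval_of_baer_resolution`). In larger
depth `N ⧸ xN` would inherit a socle element from the cokernel.

The depth conditions hold for duals, and for `Hom(N, L)` as soon as they hold for `L`. This gives
the reflexivity of `Hom(M, M)` from that of `M`. Conversely, suppose `Hom(M, M)` is reflexive and
`Ext¹(M, M) = 0`. Locally `M` maps onto the residue field `k`. A socle element of `M` gives
`M → k → M`, a socle element of `End M`; a socle element of `M ⧸ xM` gives `M → k → M ⧸ xM`, which
lifts to `M → M` because `Ext¹(M, M) = 0`, and the lift is a socle element of `End M ⧸ x End M`. As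
`End M` is a dual, neither exists. The hypothesis on `Ext¹` is localized through its elementary
form, the extendability of maps from the first syzygy of `M` to the free cover.
-/

/-! ### Injective dimension of local rings of depth at most one -/

section ExtVanishing

open Abelian

variable {A : Type u} [CommRing A] {S : ShortComplex (ModuleCat.{u} A)} (Y : ModuleCat.{u} A)

lemma CategoryTheory.ShortComplex.ShortExact.subsingleton_ext_X₁ (hS : S.ShortExact) {n : ℕ}
    (h₂ : Subsingleton (Ext S.X₂ Y n)) (h₃ : Subsingleton (Ext S.X₃ Y (n + 1))) :
    Subsingleton (Ext S.X₁ Y n) := by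
  refine subsingleton_of_forall_eq 0 fun x ↦ ?_
  obtain ⟨y, rfl⟩ := Ext.contravariant_sequence_exact₁ hS Y x (add_comm 1 n)
    (Subsingleton.elim _ _)
  rw [Subsingleton.elim y 0, Ext.comp_zero]

lemma CategoryTheory.ShortComplex.ShortExact.subsingleton_ext_X₂ (hS : S.ShortExact) {n : ℕ}
    (h₁ : Subsingleton (Ext S.X₁ Y n)) (h₃ : Subsingleton (Ext S.X₃ Y n)) :
    Subsingleton (Ext S.X₂ Y n) := by
  refine subsingleton_of_forall_eq 0 fun x ↦ ?_
  obtain ⟨y, rfl⟩ := Ext.contravariant_sequence_exact₂ hS Y x (Subsingleton.elim _ _)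
  rw [Subsingleton.elim y 0, Ext.comp_zero]

lemma CategoryTheory.ShortComplex.ShortExact.subsingleton_ext_X₃ (hS : S.ShortExact) {n : ℕ}
    (h₁ : Subsingleton (Ext S.X₁ Y n)) (h₂ : Subsingleton (Ext S.X₂ Y (n + 1))) :
    Subsingleton (Ext S.X₃ Y (n + 1)) := by
  refine subsingleton_of_forall_eq 0 fun x ↦ ?_
  obtain ⟨y, rfl⟩ := Ext.contravariant_sequence_exact₃ hS Y x (Subsingleton.elim _ _)
    (add_comm 1 n)
  rw [Subsingleton.elim y 0, Ext.comp_zero]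

/-- The quotient `A ⧸ (I : x)` embeds into `A ⧸ I` through multiplication by `x`. The ideal
`(I : x)` enters as any `I'` with the characterizing membership condition. -/
def Ideal.quotientMulMap (I I' : Ideal A) (x : A) (h : ∀ a, a ∈ I' ↔ a * x ∈ I) :
    (A ⧸ I') →ₗ[A] A ⧸ I :=
  Submodule.mapQ I' I (LinearMap.mulRight A x) fun a ha ↦ (h a).1 ha

/-- The short complex `A ⧸ (I : x) → A ⧸ I → A ⧸ (I + (x))`. -/
def Ideal.colonShortComplex (I I' : Ideal A) (x : A) (h : ∀ a, a ∈ I' ↔ a * x ∈ I) :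
    ShortComplex (ModuleCat.{u} A) :=
  ModuleCat.shortComplexOfCompEqZero (I.quotientMulMap I' x h)
    (Submodule.factor (le_sup_left : I ≤ I ⊔ Ideal.span {x})) (by
      refine LinearMap.ext fun a ↦ ?_
      obtain ⟨a, rfl⟩ := Submodule.Quotient.mk_surjective _ a
      refine (Submodule.Quotient.mk_eq_zero _).2 ?_
      exact Ideal.mem_sup_right (Ideal.mul_mem_left _ a (Ideal.mem_span_singleton_self x)))

lemma Ideal.colonShortComplex_shortExact (I I' : Ideal A) (x : A)
    (h : ∀ a, a ∈ I' ↔ a * x ∈ I) : (I.colonShortComplex I' x h).ShortExact := by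
  refine ModuleCat.shortComplex_shortExact _ ?_ ?_ ?_
  · intro b
    constructor
    · obtain ⟨b, rfl⟩ := Submodule.Quotient.mk_surjective _ b
      intro hb
      obtain ⟨i, hi, j, hj, rfl⟩ := Submodule.mem_sup.1 ((Submodule.Quotient.mk_eq_zero _).1 hb)
      obtain ⟨a, rfl⟩ := Ideal.mem_span_singleton'.1 hj
      refine ⟨Submodule.Quotient.mk a, ?_⟩
      refine (Submodule.Quotient.eq _).2 ?_
      simpa using hi
    · rintro ⟨a, rfl⟩
      exact congr($((I.colonShortComplex I' x h).zero).hom a)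
  · refine (injective_iff_map_eq_zero (I.quotientMulMap I' x h)).2 fun a ↦ ?_
    obtain ⟨a, rfl⟩ := Submodule.Quotient.mk_surjective _ a
    intro ha
    exact (Submodule.Quotient.mk_eq_zero _).2
      ((h a).2 ((Submodule.Quotient.mk_eq_zero _).1 ha))
  · exact Submodule.factor_surjective (le_sup_left : I ≤ I ⊔ Ideal.span {x})

/-- A module is injective once `Ext¹` from all cyclic modules into it vanishes. -/
lemma Module.baer_of_subsingleton_ext_one (Q : Type u) [AddCommGroup Q] [Module A Q]
    (h : ∀ I : Ideal A, Subsingleton (Ext (ModuleCat.of A (A ⧸ I)) (ModuleCat.of A Q) 1)) :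
    Module.Baer A Q := by
  intro I g
  let S := ModuleCat.shortComplexOfCompEqZero (I.subtype : I →ₗ[A] A) I.mkQ
    (LinearMap.exact_subtype_mkQ I).linearMap_comp_eq_zero
  have hS : S.ShortExact := ModuleCat.shortComplex_shortExact _
    (LinearMap.exact_subtype_mkQ I) I.injective_subtype I.mkQ_surjective
  obtain ⟨e, he⟩ := Ext.contravariant_sequence_exact₁ hS (ModuleCat.of A Q)
    (Ext.mk₀ (ModuleCat.ofHom g)) (add_zero 1) ((h I).elim _ _)
  obtain ⟨e, rfl⟩ := Ext.homEquiv₀.symm.surjective e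
  rw [Ext.homEquiv₀_symm_apply, Ext.mk₀_comp_mk₀] at he
  have he' := Ext.homEquiv₀.symm.injective he
  refine ⟨e.hom, fun x hx ↦ ?_⟩
  exact congr($(he').hom ⟨x, hx⟩)

variable [IsNoetherianRing A] [IsLocalRing A]

open IsLocalRing

/-- Nakayama's lemma for the finitely generated module `Ext Y Z n`. -/
lemma subsingleton_ext_of_smul_surjective {Z : ModuleCat.{u} A} [Module.Finite A Y]
    [Module.Finite A Z] {n : ℕ} {x : A} (hx : x ∈ maximalIdeal A)
    (h : ∀ e : Ext Y Z n, ∃ e', x • e' = e) : Subsingleton (Ext Y Z n) := by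
  rw [← Submodule.subsingleton_iff A, ← subsingleton_iff_bot_eq_top, eq_comm]
  refine Submodule.FG.eq_bot_of_le_jacobson_smul Module.Finite.fg_top fun e _ ↦ ?_
  obtain ⟨e, rfl⟩ := h e
  exact Submodule.smul_mem_smul
    (by rwa [IsLocalRing.ringJacobson_eq_maximalIdeal]) trivial

/-- The core of Bass's theorem `injdim A = depth A`: if the residue field embeds into a cyclic
module `A ⧸ J` with `Ext^(n+1)(A ⧸ J, A) = 0`, then vanishing of `Ext^(n+2)(-, A)` on cyclic
modules descends to `Ext^(n+1)(-, A)`. -/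
lemma subsingleton_ext_of_socle (n : ℕ)
    (h : ∀ I : Ideal A,
      Subsingleton (Ext (ModuleCat.of A (A ⧸ I)) (ModuleCat.of A A) (n + 1 + 1)))
    (J : Ideal A) (hJ : Subsingleton (Ext (ModuleCat.of A (A ⧸ J)) (ModuleCat.of A A) (n + 1)))
    (y : A) (hy : ∀ a, a ∈ maximalIdeal A ↔ a * y ∈ J) (I : Ideal A) :
    Subsingleton (Ext (ModuleCat.of A (A ⧸ I)) (ModuleCat.of A A) (n + 1)) := by
  induction I using IsNoetherian.induction with
  | hgt I ih =>
    by_cases hI : I = ⊤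
    · subst hI
      refine subsingleton_of_forall_eq 0 fun e ↦ ?_
      have : Subsingleton (A ⧸ (⊤ : Ideal A)) := Submodule.Quotient.subsingleton_iff.2 rfl
      have hz : 𝟙 (ModuleCat.of A (A ⧸ (⊤ : Ideal A))) = 0 := by
        exact ModuleCat.hom_ext
          (LinearMap.ext fun a ↦ Subsingleton.elim (α := A ⧸ (⊤ : Ideal A)) _ _)
      rw [← e.mk₀_id_comp, hz, Ext.mk₀_zero, Ext.zero_comp]
    by_cases hIm : I = maximalIdeal A
    · subst hIm
      exact (J.colonShortComplex_shortExact (maximalIdeal A) y hy).subsingleton_ext_X₁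
        (ModuleCat.of A A) hJ (h _)
    obtain ⟨x, hxm, hxI⟩ := SetLike.exists_of_lt (lt_of_le_of_ne (le_maximalIdeal hI) hIm)
    have hlt : I < I ⊔ Ideal.span {x} := by
      refine lt_of_le_of_ne le_sup_left fun he ↦ hxI ?_
      rw [he]
      exact Ideal.mem_sup_right (Ideal.mem_span_singleton_self x)
    -- If `(I : x) = I`, then `x` acts surjectively on `Ext^(n+1)(A ⧸ I, A)`; otherwise both outer
    -- terms of `A ⧸ (I : x) → A ⧸ I → A ⧸ (I + (x))` have larger ideals.
    by_cases hc : ∀ a, a ∈ I ↔ a * x ∈ I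
    · have hS := Ideal.colonShortComplex_shortExact I I x hc
      have : Module.Finite A (ModuleCat.of A (A ⧸ I)) := inferInstanceAs (Module.Finite A (A ⧸ I))
      have : Module.Finite A (ModuleCat.of A A) := inferInstanceAs (Module.Finite A A)
      refine subsingleton_ext_of_smul_surjective _ hxm fun e ↦ ?_
      obtain ⟨e', he'⟩ := Ext.contravariant_sequence_exact₁ hS (ModuleCat.of A A) e
        (add_comm 1 (n + 1)) ((h _).elim _ _)
      have hf : (Ideal.colonShortComplex I I x hc).f = x • 𝟙 (ModuleCat.of A (A ⧸ I)) := by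
        refine ModuleCat.hom_ext (LinearMap.ext fun a ↦ ?_)
        obtain ⟨a, rfl⟩ := Submodule.Quotient.mk_surjective _ a
        exact congrArg Submodule.Quotient.mk (mul_comm a x)
      have hsmul : ∀ b : Ext (ModuleCat.of A (A ⧸ I)) (ModuleCat.of A A) (n + 1),
          (Ext.mk₀ (x • 𝟙 (ModuleCat.of A (A ⧸ I)))).comp b (zero_add _) = x • b := fun b ↦ by
        rw [Ext.mk₀_smul, Ext.smul_comp, Ext.mk₀_id_comp]
      rw [hf] at he'
      exact ⟨e', (hsmul e').symm.trans he'⟩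
    · let I' : Ideal A := I.comap (LinearMap.mulRight A x)
      have hI' : ∀ a, a ∈ I' ↔ a * x ∈ I := fun a ↦ Iff.rfl
      have hle : I ≤ I' := fun a ha ↦ Ideal.mul_mem_right x I ha
      have hlt' : I < I' := lt_of_le_of_ne hle fun he ↦ hc fun a ↦ by rw [← hI', ← he]
      exact (Ideal.colonShortComplex_shortExact I I' x hI').subsingleton_ext_X₂ _
        (ih _ hlt') (ih _ hlt)

/-- Descent of Bass's theorem iterated: if `A` has finite injective dimension and
`Ext^(n+1)(A ⧸ J, A) = 0` for all `n ≥ k`, where the residue field embeds into `A ⧸ J`, then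
`Ext^(k+1)(-, A)` vanishes on cyclic modules. -/
lemma subsingleton_ext_of_socle_of_hasInjectiveDimensionLE {d : ℕ}
    (hd : HasInjectiveDimensionLE (ModuleCat.of A A) d) (k : ℕ)
    (J : Ideal A)
    (hJ : ∀ n, k ≤ n → Subsingleton (Ext (ModuleCat.of A (A ⧸ J)) (ModuleCat.of A A) (n + 1)))
    (y : A) (hy : ∀ a, a ∈ maximalIdeal A ↔ a * y ∈ J) (I : Ideal A) :
    Subsingleton (Ext (ModuleCat.of A (A ⧸ I)) (ModuleCat.of A A) (k + 1)) := by
  have key : ∀ m, ∀ I : Ideal A,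
      Subsingleton (Ext (ModuleCat.of A (A ⧸ I)) (ModuleCat.of A A) (k + (d - m) + 1)) := by
    intro m
    induction m with
    | zero =>
      intro I
      exact HasInjectiveDimensionLT.subsingleton _ (d + 1) _ (by lia) _
    | succ m ih =>
      by_cases hm : d ≤ m
      · rwa [show d - (m + 1) = d - m by lia]
      · rw [show k + (d - m) + 1 = k + (d - (m + 1)) + 1 + 1 by lia] at ih
        exact subsingleton_ext_of_socle _ ih J (hJ _ (by lia)) y hy
  simpa using key d I

/-- A local ring of finite injective dimension and depth zero is self-injective. -/
lemma baer_self_of_socle {d : ℕ} (hd : HasInjectiveDimensionLE (ModuleCat.of A A) d)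
    {y : A} (hy0 : y ≠ 0) (hy : ∀ a ∈ maximalIdeal A, a * y = 0) : Module.Baer A A := by
  refine Module.baer_of_subsingleton_ext_one A ?_
  have hp : Projective (ModuleCat.of A (A ⧸ (⊥ : Ideal A))) :=
    (IsProjective.iff_projective _).1
      (Module.Projective.of_equiv (Submodule.quotEquivOfEqBot (⊥ : Ideal A) rfl).symm)
  refine subsingleton_ext_of_socle_of_hasInjectiveDimensionLE hd 0 ⊥
    (fun n _ ↦ subsingleton_of_forall_eq 0 fun e ↦ e.eq_zero_of_projective) y fun a ↦ ?_
  refine ⟨fun ha ↦ hy a ha, fun ha ↦ ?_⟩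
  by_contra hu
  have hu : IsUnit a := by simpa using hu
  exact hy0 (hu.mul_right_eq_zero.1 ha)

/-- A local ring of finite injective dimension and depth one has an injective resolution
of length one. -/
lemma exists_baer_resolution_of_socle_quotient {d : ℕ}
    (hd : HasInjectiveDimensionLE (ModuleCat.of A A) d)
    {x y : A} (hx : IsSMulRegular A x) (hyx : ¬ x ∣ y)
    (hy : ∀ a ∈ maximalIdeal A, x ∣ a * y) :
    ∃ (Q Q' : ModuleCat.{u} A) (ι : A →ₗ[A] Q) (ρ : Q →ₗ[A] Q'), Module.Baer A Q ∧
      Module.Baer A Q' ∧ Function.Injective ι ∧ Function.Surjective ρ ∧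
      Function.Exact ι ρ := by
  have hJ : ∀ n, 1 ≤ n → Subsingleton
      (Ext (ModuleCat.of A (A ⧸ Ideal.span {x})) (ModuleCat.of A A) (n + 1)) := by
    intro n hn
    obtain ⟨n, rfl⟩ := Nat.exists_eq_add_of_le' hn
    have hS := (⊥ : Ideal A).colonShortComplex_shortExact ⊥ x fun a ↦ by
      refine ⟨fun ha ↦ Ideal.mul_mem_right x _ ha, fun ha ↦ ?_⟩
      refine hx ?_
      simpa [mul_comm] using ha
    have hp : Projective (ModuleCat.of A (A ⧸ (⊥ : Ideal A))) :=
      (IsProjective.iff_projective _).1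
        (Module.Projective.of_equiv (Submodule.quotEquivOfEqBot (⊥ : Ideal A) rfl).symm)
    have hP : ∀ n, Subsingleton
        (Ext (ModuleCat.of A (A ⧸ (⊥ : Ideal A))) (ModuleCat.of A A) (n + 1)) :=
      fun n ↦ subsingleton_of_forall_eq 0 fun e ↦ e.eq_zero_of_projective
    have := hS.subsingleton_ext_X₃ (ModuleCat.of A A) (hP n) (hP (n + 1))
    rw [← bot_sup_eq (Ideal.span {x})]
    exact this
  have hW := subsingleton_ext_of_socle_of_hasInjectiveDimensionLE hd 1 (Ideal.span {x}) hJ y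
    fun a ↦ by
      rw [Ideal.mem_span_singleton]
      refine ⟨hy a, fun ha ↦ ?_⟩
      by_contra hu
      have hu : IsUnit a := by simpa using hu
      exact hyx (hu.dvd_mul_left.1 ha)
  let ⟨Q, _, f, _⟩ := EnoughInjectives.presentation (ModuleCat.of A A)
  have hf : Function.Injective f.hom := (ModuleCat.mono_iff_injective f).mp ‹_›
  let S := ModuleCat.shortComplexOfCompEqZero f.hom (LinearMap.range f.hom).mkQ
    f.hom.exact_map_mkQ_range.linearMap_comp_eq_zero
  have hS : S.ShortExact := ModuleCat.shortComplex_shortExact S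
    f.hom.exact_map_mkQ_range hf (Submodule.mkQ_surjective _)
  refine ⟨Q, ModuleCat.of A (Q ⧸ LinearMap.range f.hom), f.hom, (LinearMap.range f.hom).mkQ,
    Module.Baer.of_injective (Module.injective_module_of_injective_object A Q), ?_, hf,
    Submodule.mkQ_surjective _, f.hom.exact_map_mkQ_range⟩
  refine Module.baer_of_subsingleton_ext_one _ fun I ↦ subsingleton_of_forall_eq 0 fun e ↦ ?_
  obtain ⟨e, rfl⟩ := Ext.covariant_sequence_exact₃ _ hS e rfl ((hW I).elim _ _)
  rw [show e = 0 from e.eq_zero_of_injective, Ext.zero_comp]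

end ExtVanishing

/-! ### Socle conditions over local rings -/

section Local

open IsLocalRing Module

/-- The socle `Hom(k, N)` of a module `N` over a local ring with residue field `k` vanishes;
for finitely generated `N` over a noetherian ring this says `N = 0` or `depth N ≥ 1`. -/
def IsSocleFree (A : Type*) [CommRing A] [IsLocalRing A] (N : Type*) [AddCommGroup N]
    [Module A N] : Prop :=
  ∀ n : N, (∀ a ∈ maximalIdeal A, a • n = 0) → n = 0

/-- The socle of `N ⧸ xN` vanishes, phrased through representatives in `N`. -/
def IsSocleFreeMod {A : Type*} [CommRing A] [IsLocalRing A] (x : A) (N : Type*) [AddCommGroup N]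
    [Module A N] : Prop :=
  ∀ n : N, (∀ a ∈ maximalIdeal A, ∃ n', a • n = x • n') → ∃ n', n = x • n'

section Dual

variable {A : Type*} [CommRing A] {N : Type*} [AddCommGroup N] [Module A N]

lemma IsSMulRegular.linearMap {x : A} {L : Type*} [AddCommGroup L] [Module A L]
    (hx : IsSMulRegular L x) : IsSMulRegular (N →ₗ[A] L) x :=
  fun _ _ h ↦ LinearMap.ext fun n ↦ hx (LinearMap.congr_fun h n)

/-- A linear map all of whose values are divisible by a regular element is itself divisible. -/
lemma exists_eq_smul_linearMap {x : A} {L : Type*} [AddCommGroup L] [Module A L]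
    (hx : IsSMulRegular L x) (f : N →ₗ[A] L) (h : ∀ n, ∃ l, f n = x • l) :
    ∃ g : N →ₗ[A] L, f = x • g := by
  choose g hg using h
  refine ⟨{ toFun := g, map_add' := fun a b ↦ hx ?_, map_smul' := fun a b ↦ hx ?_ },
    LinearMap.ext hg⟩
  · simp only [smul_add, ← hg, map_add]
  · simp only [RingHom.id_apply]
    rw [smul_comm x a, ← hg, ← hg, map_smul]

lemma IsSMulRegular.of_injective_eval {x : A} (hx : IsSMulRegular A x)
    (h : Function.Injective (Dual.eval A N)) : IsSMulRegular N x := by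
  intro a b hab
  exact h (hx.linearMap (by simpa using congrArg (Dual.eval A N) hab))

variable [IsLocalRing A]

lemma IsSocleFreeMod.linearMap {x : A} {L : Type*} [AddCommGroup L] [Module A L]
    (hx : IsSMulRegular L x) (h : IsSocleFreeMod x L) : IsSocleFreeMod x (N →ₗ[A] L) := by
  intro f hf
  refine exists_eq_smul_linearMap hx f fun n ↦ h (f n) fun a ha ↦ ?_
  obtain ⟨g, hg⟩ := hf a ha
  exact ⟨g n, LinearMap.congr_fun hg n⟩

lemma IsSocleFreeMod.of_equiv {x : A} {L : Type*} [AddCommGroup L] [Module A L]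
    (e : L ≃ₗ[A] N) (h : IsSocleFreeMod x L) : IsSocleFreeMod x N := by
  intro n hn
  obtain ⟨l, hl⟩ := h (e.symm n) fun a ha ↦ by
    obtain ⟨n', hn'⟩ := hn a ha
    exact ⟨e.symm n', by rw [← map_smul, hn', map_smul]⟩
  exact ⟨e l, by rw [← map_smul, ← hl, e.apply_symm_apply]⟩

lemma IsSocleFree.of_isSMulRegular {x : A} (hx : x ∈ maximalIdeal A) (h : IsSMulRegular N x) :
    IsSocleFree A N :=
  fun _ hn ↦ h.right_eq_zero_of_smul (hn x hx)

end Dual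

/-! ### Biduality over self-injective rings -/

section SelfInjective

variable {A : Type*} [CommRing A]

/-- Over a self-injective ring a functional on `N*` extends to the dual of a finite free cover
of `N`, where it is an evaluation. -/
lemma Module.Baer.eval_surjective (hA : Baer A A) (N : Type*) [AddCommGroup N] [Module A N]
    [Module.Finite A N] : Function.Surjective (Dual.eval A N) := by
  intro c
  obtain ⟨n, π, hπ⟩ := Module.Finite.exists_fin' A N
  have hinj : Function.Injective (Dual.transpose (R := A) π) :=
    LinearMap.dualMap_injective_of_surjective hπ
  obtain ⟨d, hd⟩ := hA.extension_property _ hinj c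
  obtain ⟨f, rfl⟩ := (bijective_dual_eval A (Fin n → A)).2 d
  exact ⟨π f, by rw [← hd]; rfl⟩

lemma Module.Baer.eval_injective [IsNoetherianRing A] (hA : Baer A A) (N : Type*)
    [AddCommGroup N] [Module A N] [Module.Finite A N] : Function.Injective (Dual.eval A N) := by
  rw [injective_iff_map_eq_zero]
  intro y hy
  obtain ⟨n, π, hπ⟩ := Module.Finite.exists_fin' A N
  obtain ⟨f, rfl⟩ := hπ y
  -- Evaluation at `f` kills the functionals vanishing on `ker π`, so it factors through their
  -- restrictions to `ker π`, where it becomes evaluation at an element of `ker π`.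
  let res : Dual A (Fin n → A) →ₗ[A] Dual A (LinearMap.ker π) :=
    (LinearMap.ker π).subtype.dualMap
  have hres : LinearMap.ker res ≤ LinearMap.ker (Dual.eval A (Fin n → A) f) := by
    intro φ hφ
    have hφ' : LinearMap.ker π ≤ LinearMap.ker φ := fun k hk ↦
      LinearMap.congr_fun (LinearMap.mem_ker.1 hφ) ⟨k, hk⟩
    obtain ⟨ψ, hψ⟩ : ∃ ψ : N →ₗ[A] A, ψ ∘ₗ π = φ := by
      refine ⟨(LinearMap.ker π).liftQ φ hφ' ∘ₗ
        (π.quotKerEquivOfSurjective hπ).symm.toLinearMap, LinearMap.ext fun z ↦ ?_⟩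
      have : (π.quotKerEquivOfSurjective hπ).symm (π z) = Submodule.Quotient.mk z := by
        rw [LinearEquiv.symm_apply_eq]; rfl
      simp [this]
    have := LinearMap.congr_fun hy ψ
    simpa [← hψ] using this
  obtain ⟨c, hc⟩ := hA.extension_property ((LinearMap.ker res).liftQ res le_rfl)
    (LinearMap.ker_eq_bot.1 (Submodule.ker_liftQ_eq_bot _ _ _ le_rfl))
    ((LinearMap.ker res).liftQ _ hres)
  obtain ⟨k, rfl⟩ := hA.eval_surjective (LinearMap.ker π) c
  have hfk : f = k := by
    refine (bijective_dual_eval A (Fin n → A)).1 (LinearMap.ext fun φ ↦ ?_)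
    exact (LinearMap.congr_fun hc (Submodule.Quotient.mk φ)).symm
  rw [hfk]
  exact k.2

end SelfInjective

/-! ### The cokernel of biduality in positive depth -/

section Cokernel

variable {A : Type*} [CommRing A] [IsLocalRing A]
  {N : Type*} [AddCommGroup N] [Module A N]

/-- If `N ⧸ xN` has no socle for some regular `x`, neither has the cokernel of the biduality map:
a socle element `c` of the cokernel gives the socle element `x c` of `N ⧸ xN`. -/
lemma mem_range_eval_of_isSocleFreeMod {x : A} (hx : IsSMulRegular A x)
    (hxm : x ∈ maximalIdeal A)
    (hN : Function.Injective (Dual.eval A N)) (hs : IsSocleFreeMod x N)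
    (c : Dual A (Dual A N))
    (hc : ∀ a ∈ maximalIdeal A, a • c ∈ LinearMap.range (Dual.eval A N)) :
    c ∈ LinearMap.range (Dual.eval A N) := by
  obtain ⟨n, hn⟩ := hc x hxm
  obtain ⟨n', rfl⟩ := hs n fun a ha ↦ by
    obtain ⟨n', hn'⟩ := hc a ha
    refine ⟨n', hN ?_⟩
    rw [map_smul, map_smul, hn, hn', smul_comm]
  rw [map_smul] at hn
  exact ⟨n', hx.linearMap hn⟩

/-- A socle element of a module can be sent to any socle element of an injective module. -/
lemma Module.Baer.exists_linearMap_apply_eq {Q : Type*} [AddCommGroup Q] [Module A Q]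
    (hQ : Baer A Q) {n : N} (hn0 : n ≠ 0) {w : Q}
    (hw : ∀ a ∈ maximalIdeal A, a • w = 0) : ∃ φ : N →ₗ[A] Q, φ n = w := by
  have hann : ∀ a : A, a • n = 0 → a ∈ maximalIdeal A := fun a ha ↦ by
    by_contra hu
    have hu : IsUnit a := by simpa using hu
    exact hn0 (hu.smul_eq_zero.1 ha)
  let f := LinearMap.toSpanSingleton A N n
  obtain ⟨φ, hφ⟩ := hQ.extension_property ((LinearMap.ker f).liftQ f le_rfl)
    (LinearMap.ker_eq_bot.1 (Submodule.ker_liftQ_eq_bot _ _ _ le_rfl))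
    ((LinearMap.ker f).liftQ (LinearMap.toSpanSingleton A Q w) fun a ha ↦
      hw a (hann a (by simpa [f] using ha)))
  refine ⟨φ, ?_⟩
  have h1 : φ ((1 : A) • n) = (1 : A) • w := LinearMap.congr_fun hφ (Submodule.Quotient.mk 1)
  simpa using h1

/-- In depth one, an injective resolution `0 → A → Q → Q' → 0` forces the cokernel of the
biduality map to have no socle. The bidual embeds in a free module, so `Ext¹(N**, A) = 0`. A socle
element `c` of the cokernel would, through a lift along `N** → Q → Q'`, turn a socle element of
`A ⧸ xA` into one of `A`. -/
lemma mem_range_eval_of_baer_resolution [IsNoetherianRing A] [Module.Finite A N]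
    {Q Q' : Type*} [AddCommGroup Q] [Module A Q]
    [AddCommGroup Q'] [Module A Q'] {ι : A →ₗ[A] Q} {ρ : Q →ₗ[A] Q'} (hQ : Baer A Q)
    (hQ' : Baer A Q') (hι : Function.Injective ι) (hex : Function.Exact ι ρ)
    (hρ : Function.Surjective ρ)
    {x y : A} (hx : IsSMulRegular A x) (hxm : x ∈ maximalIdeal A) (hyx : ¬ x ∣ y)
    (hy : ∀ a ∈ maximalIdeal A, x ∣ a * y) (c : Dual A (Dual A N))
    (hc : ∀ a ∈ maximalIdeal A, a • c ∈ LinearMap.range (Dual.eval A N)) :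
    c ∈ LinearMap.range (Dual.eval A N) := by
  by_contra hcN
  have hxinj : Function.Injective (LinearMap.mulLeft A x) := fun a b h ↦ hx h
  obtain ⟨h, hh⟩ := hQ.extension_property _ hxinj ι
  have hu : ∀ a, h (x * a) = ι a := fun a ↦ LinearMap.congr_fun hh a
  -- `h y` is `y / x`, a socle element modulo `A`.
  obtain ⟨φ, hφ⟩ := hQ'.exists_linearMap_apply_eq
    (n := (LinearMap.range (Dual.eval A N)).mkQ c) (w := ρ (h y))
    (by simpa using hcN) (fun a ha ↦ by
      obtain ⟨b, hb⟩ := hy a ha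
      rw [← map_smul, ← map_smul, smul_eq_mul, hb, hu]
      exact hex.apply_apply_eq_zero b)
  obtain ⟨k, π, hπ⟩ := Module.Finite.exists_fin' A (Dual A N)
  obtain ⟨Φ, hΦ⟩ := hQ'.extension_property π.dualMap
    (LinearMap.dualMap_injective_of_surjective hπ) (φ ∘ₗ (LinearMap.range (Dual.eval A N)).mkQ)
  obtain ⟨Ψ, hΨ⟩ := Module.projective_lifting_property ρ Φ hρ
  let ψ : Dual A (Dual A N) →ₗ[A] Q := Ψ ∘ₗ π.dualMap
  have hψ : ∀ d, ρ (ψ d) = φ (Submodule.Quotient.mk d) := fun d ↦ by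
    have h1 := LinearMap.congr_fun hΨ (π.dualMap d)
    have h2 := LinearMap.congr_fun hΦ d
    simp only [LinearMap.comp_apply] at h1 h2
    exact h1.trans h2
  -- On `N` the lift `ψ` has values in `A`, so it is evaluation at some `f` in `N*`; subtracting
  -- this evaluation makes it vanish on `N`.
  have hmem : ∀ n, ψ (Dual.eval A N n) ∈ LinearMap.range ι := fun n ↦ by
    refine (hex _).1 ?_
    have : (Submodule.Quotient.mk (Dual.eval A N n) :
        Dual A (Dual A N) ⧸ LinearMap.range (Dual.eval A N)) = 0 :=
      (Submodule.Quotient.mk_eq_zero _).2 (LinearMap.mem_range_self _ n)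
    rw [hψ, this, map_zero]
  let e := LinearEquiv.ofInjective ι hι
  let f : Dual A N := e.symm.toLinearMap ∘ₗ (ψ ∘ₗ Dual.eval A N).codRestrict _ hmem
  have hf : ∀ n, ι (f n) = ψ (Dual.eval A N n) := fun n ↦
    congrArg Subtype.val (e.apply_symm_apply ⟨ψ (Dual.eval A N n), hmem n⟩)
  let ψ' : Dual A (Dual A N) →ₗ[A] Q := ψ - ι ∘ₗ Dual.eval A (Dual A N) f
  have hψ'N : ∀ n, ψ' (Dual.eval A N n) = 0 := fun n ↦ by
    simp only [ψ', LinearMap.sub_apply, LinearMap.comp_apply, Dual.eval_apply, hf, sub_self]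
  -- `ψ' c` is killed by `x` and lifts the class of `y / x`, which forces `y ∈ xA`.
  have hz : x • ψ' c = 0 := by
    obtain ⟨n, hn⟩ := hc x hxm
    rw [← map_smul, ← hn, hψ'N]
  have hρz : ρ (ψ' c - h y) = 0 := by
    simp only [ψ', map_sub, LinearMap.sub_apply, LinearMap.comp_apply, hψ,
      hex.apply_apply_eq_zero, sub_zero]
    exact sub_eq_zero.2 hφ
  obtain ⟨r, hr⟩ := (hex _).1 hρz
  have : ι (x * r + y) = 0 := by
    rw [map_add, ← smul_eq_mul, map_smul, hr, smul_sub, hz, ← map_smul, smul_eq_mul, hu]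
    simp
  have hxy : x * r + y = 0 := hι (by rw [this, map_zero])
  exact hyx ⟨-r, by linear_combination hxy⟩

end Cokernel

/-! ### Biduality over Gorenstein local rings -/

section Gorenstein

variable {A : Type u} [CommRing A] [IsLocalRing A] [IsNoetherianRing A]
  {N : Type*} [AddCommGroup N] [Module A N]

/-- In a noetherian local ring without socle, the maximal ideal contains a regular element. -/
lemma IsSocleFree.exists_isSMulRegular (h : IsSocleFree A A) :
    ∃ x ∈ maximalIdeal A, IsSMulRegular A x := by
  have hsub : Subsingleton ((A ⧸ maximalIdeal A) →ₗ[A] A) := by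
    refine subsingleton_of_forall_eq 0 fun f ↦ ?_
    refine Submodule.linearMap_qext _ (LinearMap.ext_ring ?_)
    refine h _ fun a ha ↦ ?_
    rw [← map_smul, smul_eq_mul, mul_one]
    simp [(Ideal.Quotient.eq_zero_iff_mem (I := maximalIdeal A)).2 ha]
  obtain ⟨x, hx, hreg⟩ := IsSMulRegular.subsingleton_linearMap_iff.1 hsub
  exact ⟨x, by simpa [Ideal.annihilator_quotient] using hx, hreg⟩

/-- Over a Gorenstein local ring the kernel of biduality has no socle, if `N` has none whenever
the depth of the ring is positive. -/
lemma eq_zero_of_eval_eq_zero_of_socle [Module.Finite A N] {d : ℕ}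
    (hd : HasInjectiveDimensionLE (ModuleCat.of A A) d)
    (hN : ∀ x ∈ maximalIdeal A, IsSMulRegular A x → IsSocleFree A N) {n : N}
    (hn : Dual.eval A N n = 0) (hm : ∀ a ∈ maximalIdeal A, a • n = 0) : n = 0 := by
  by_cases h : IsSocleFree A A
  · obtain ⟨x, hxm, hx⟩ := h.exists_isSMulRegular
    exact hN x hxm hx n hm
  · simp only [IsSocleFree, not_forall] at h
    obtain ⟨y, hy, hy0⟩ := h
    exact (baer_self_of_socle hd hy0 hy).eval_injective N (hn.trans (map_zero _).symm)

/-- Over a Gorenstein local ring the cokernel of biduality has no socle, if `N ⧸ xN` has none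
whenever the ring has depth at least two. -/
lemma mem_range_eval_of_socle [Module.Finite A N] {d : ℕ}
    (hd : HasInjectiveDimensionLE (ModuleCat.of A A) d)
    (hinj : Function.Injective (Dual.eval A N))
    (hN : ∀ x ∈ maximalIdeal A, IsSMulRegular A x → IsSocleFreeMod x A → IsSocleFreeMod x N)
    (c : Dual A (Dual A N))
    (hc : ∀ a ∈ maximalIdeal A, a • c ∈ LinearMap.range (Dual.eval A N)) :
    c ∈ LinearMap.range (Dual.eval A N) := by
  by_cases h : IsSocleFree A A
  · obtain ⟨x, hxm, hx⟩ := h.exists_isSMulRegular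
    by_cases h2 : IsSocleFreeMod x A
    · exact mem_range_eval_of_isSocleFreeMod hx hxm hinj (hN x hxm hx h2) c hc
    · simp only [IsSocleFreeMod, not_forall] at h2
      obtain ⟨y, hy, hyx⟩ := h2
      obtain ⟨Q, Q', ι, ρ, hQ, hQ', hι, hρ, hex⟩ :=
        exists_baer_resolution_of_socle_quotient hd hx hyx hy
      exact mem_range_eval_of_baer_resolution hQ hQ' hι hex hρ hx hxm hyx hy c hc
  · simp only [IsSocleFree, not_forall] at h
    obtain ⟨y, hy, hy0⟩ := h
    exact (baer_self_of_socle hd hy0 hy).eval_surjective N c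

end Gorenstein

/-! ### Socle conditions on endomorphism modules -/

section Endomorphisms

/-- If `Ext¹(M, L) = 0`, witnessed by extending maps along `K → F → M → 0` with `F` projective,
then maps `M → L ⧸ xL` lift to `L`. -/
lemma exists_lift_of_forall_exists_extension {A K F L M : Type*} [CommRing A]
    [AddCommGroup M] [Module A M] [AddCommGroup K] [Module A K]
    [AddCommGroup F] [Module A F] [Module.Projective A F] [AddCommGroup L] [Module A L]
    {i : K →ₗ[A] F} {π : F →ₗ[A] M} (hπ : Function.Surjective π) (hex : Function.Exact i π)
    (hext : ∀ h : K →ₗ[A] L, ∃ h' : F →ₗ[A] L, h' ∘ₗ i = h)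
    {x : A} (hx : IsSMulRegular L x) (g : M →ₗ[A] L ⧸ LinearMap.range (LinearMap.lsmul A L x)) :
    ∃ h : M →ₗ[A] L, (LinearMap.range (LinearMap.lsmul A L x)).mkQ ∘ₗ h = g := by
  obtain ⟨h, hh⟩ := Module.projective_lifting_property
    (LinearMap.range (LinearMap.lsmul A L x)).mkQ (g ∘ₗ π) (Submodule.mkQ_surjective _)
  obtain ⟨k, hk⟩ := exists_eq_smul_linearMap hx (h ∘ₗ i) fun z ↦ by
    have : (LinearMap.range (LinearMap.lsmul A L x)).mkQ (h (i z)) = 0 := by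
      have := LinearMap.congr_fun hh (i z)
      simp only [LinearMap.comp_apply] at this
      rw [this, hex.apply_apply_eq_zero, map_zero]
    obtain ⟨l, hl⟩ := (Submodule.Quotient.mk_eq_zero _).1 this
    exact ⟨l, hl.symm⟩
  obtain ⟨k', rfl⟩ := hext k
  -- On `K` the lift `h` is `x` times a map that extends to `F`; the correction descends to `M`.
  have hker : LinearMap.ker π ≤ LinearMap.ker (h - x • k') := by
    intro f hf
    obtain ⟨z, rfl⟩ := (hex f).1 hf
    have := LinearMap.congr_fun hk z
    simpa [sub_eq_zero] using this
  refine ⟨(LinearMap.ker π).liftQ _ hker ∘ₗ (π.quotKerEquivOfSurjective hπ).symm.toLinearMap,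
    LinearMap.ext fun m ↦ ?_⟩
  obtain ⟨f, rfl⟩ := hπ m
  have h1 : (π.quotKerEquivOfSurjective hπ).symm (π f) = Submodule.Quotient.mk f := by
    rw [LinearEquiv.symm_apply_eq]; rfl
  have h2 : (Submodule.Quotient.mk (x • k' f) : L ⧸ LinearMap.range (LinearMap.lsmul A L x)) = 0 :=
    (Submodule.Quotient.mk_eq_zero _).2 ⟨k' f, rfl⟩
  have h3 := LinearMap.congr_fun hh f
  simp only [LinearMap.comp_apply, Submodule.mkQ_apply] at h3
  simp only [LinearMap.comp_apply, LinearEquiv.coe_coe, h1, Submodule.liftQ_apply,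
    LinearMap.sub_apply, LinearMap.smul_apply, Submodule.mkQ_apply, Submodule.Quotient.mk_sub,
    h2, sub_zero, h3]

variable {A : Type*} [CommRing A] [IsLocalRing A]
  {M : Type*} [AddCommGroup M] [Module A M] [Module.Finite A M]

/-- A nonzero finitely generated module maps onto the residue field by Nakayama, hence maps
onto the line spanned by any socle element. -/
lemma exists_linearMap_apply_eq_of_socle [Nontrivial M] {N : Type*} [AddCommGroup N] [Module A N]
    {n : N} (hn : ∀ a ∈ maximalIdeal A, a • n = 0) :
    ∃ (g : M →ₗ[A] N) (y : M), g y = n ∧ ∀ a ∈ maximalIdeal A, a • g = 0 := by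
  have hne : (⊤ : Submodule A M) ≠ maximalIdeal A • ⊤ :=
    Submodule.top_ne_ideal_smul_of_le_jacobson_annihilator (maximalIdeal_le_jacobson _)
  obtain ⟨y, hy⟩ : ∃ y, y ∉ maximalIdeal A • (⊤ : Submodule A M) := by
    by_contra! h
    exact hne (Submodule.eq_top_iff'.2 h).symm
  let V := M ⧸ (maximalIdeal A • (⊤ : Submodule A M))
  let _ : Field (A ⧸ maximalIdeal A) := Ideal.Quotient.field _
  have hy' : (Submodule.Quotient.mk y : V) ≠ 0 := by simpa [V] using hy
  obtain ⟨φ, hφ⟩ := Module.Projective.exists_dual_ne_zero (A ⧸ maximalIdeal A) hy'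
  let s : (A ⧸ maximalIdeal A) →ₗ[A] N :=
    (maximalIdeal A).liftQ (LinearMap.toSpanSingleton A N n) fun a ha ↦ by simpa using hn a ha
  let g : M →ₗ[A] N := s ∘ₗ φ.restrictScalars A ∘ₗ Submodule.mkQ _
  obtain ⟨b, hb⟩ := Ideal.Quotient.mk_surjective (φ (Submodule.Quotient.mk y))⁻¹
  refine ⟨g, b • y, ?_, fun a ha ↦ LinearMap.ext fun z ↦ ?_⟩
  · have h1 : φ (Submodule.Quotient.mk (b • y)) = 1 := by
      have : (Submodule.Quotient.mk (b • y) : V) =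
          (Ideal.Quotient.mk (maximalIdeal A) b) • (Submodule.Quotient.mk y : V) := rfl
      rw [this, map_smul, hb, smul_eq_mul, inv_mul_cancel₀ hφ]
    change s (φ (Submodule.Quotient.mk (b • y))) = n
    rw [h1]
    change (1 : A) • n = n
    rw [one_smul]
  · obtain ⟨r, hr⟩ := Ideal.Quotient.mk_surjective (φ (Submodule.Quotient.mk z))
    change a • s (φ (Submodule.Quotient.mk z)) = 0
    rw [← hr]
    change a • r • n = 0
    rw [smul_comm, hn a ha, smul_zero]

/-- A socle element `n` of `M` gives a socle element of `End M` with `n` among its values. -/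
lemma IsSocleFree.of_end (h : IsSocleFree A (M →ₗ[A] M)) : IsSocleFree A M := by
  intro n hn
  nontriviality M
  obtain ⟨g, y, rfl, hg⟩ := exists_linearMap_apply_eq_of_socle (M := M) hn
  rw [h g hg, LinearMap.zero_apply]

/-- When maps `M → M ⧸ xM` lift to endomorphisms, a socle element of `M ⧸ xM` yields one of
`End M ⧸ x End M`. -/
lemma IsSocleFreeMod.of_end {x : A} (hx : IsSMulRegular M x)
    (hlift : ∀ g : M →ₗ[A] M ⧸ LinearMap.range (LinearMap.lsmul A M x),
      ∃ h : M →ₗ[A] M, (LinearMap.range (LinearMap.lsmul A M x)).mkQ ∘ₗ h = g)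
    (h : IsSocleFreeMod x (M →ₗ[A] M)) : IsSocleFreeMod x M := by
  intro n hn
  nontriviality M
  have hmem : ∀ m : M, (LinearMap.range (LinearMap.lsmul A M x)).mkQ m = 0 → ∃ l, m = x • l :=
    fun m hm ↦ by
      obtain ⟨l, hl⟩ := (Submodule.Quotient.mk_eq_zero _).1 hm
      exact ⟨l, hl.symm⟩
  obtain ⟨g, y, hgy, hg⟩ := exists_linearMap_apply_eq_of_socle (M := M)
    (n := (LinearMap.range (LinearMap.lsmul A M x)).mkQ n) fun a ha ↦ by
      obtain ⟨l, hl⟩ := hn a ha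
      rw [← map_smul, hl]
      exact (Submodule.Quotient.mk_eq_zero _).2 ⟨l, rfl⟩
  -- The lift `f` is a socle element of `End M ⧸ x End M`, as `a • f` has values in `xM`.
  obtain ⟨f, rfl⟩ := hlift g
  obtain ⟨f', rfl⟩ := h f fun a ha ↦ by
    obtain ⟨l, hl⟩ := exists_eq_smul_linearMap hx (a • f) fun m ↦ hmem _ <| by
      simpa using LinearMap.congr_fun (hg a ha) m
    exact ⟨l, hl⟩
  refine hmem n ?_
  rw [← hgy]
  exact (Submodule.Quotient.mk_eq_zero _).2 ⟨f' y, rfl⟩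

end Endomorphisms

end Local

/-! ### Localizations of Gorenstein rings -/

section LocalizationGorenstein

lemma hasInjectiveDimensionLE_localization {B : Type u} [CommRing B] [IsNoetherianRing B]
    (S : Submonoid B) {M : ModuleCat.{u} B} {d : ℕ} (h : HasInjectiveDimensionLE M d)
    (e : M ≃ₗ[B] B) :
    HasInjectiveDimensionLE (ModuleCat.of (Localization S) (Localization S)) d :=
  (ModuleCat.hasInjectiveDimensionLE_iff_of_linearEquiv
    (M := ModuleCat.of (Localization S) (Localization S))
    (N := M.localizedModule S)
    (LinearEquiv.extendScalarsOfIsLocalization S (Localization S)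
      (IsLocalizedModule.linearEquiv S (Algebra.linearMap B (Localization S) ∘ₗ e.toLinearMap)
        (M.localizedModuleMkLinearMap S))) d).2
    (M.localizedModule_hasInjectiveDimensionLE d S)

/-- All localizations of a Gorenstein ring at prime ideals, not only at maximal ones, have finite
injective dimension. -/
lemma IsGorensteinRing.exists_hasInjectiveDimensionLE (R : Type u) [CommRing R]
    [IsGorensteinRing R] (p : Ideal R) [p.IsPrime] :
    ∃ d, HasInjectiveDimensionLE
      (ModuleCat.of (Localization.AtPrime p) (Localization.AtPrime p)) d := by
  obtain ⟨m, hm, hpm⟩ := p.exists_le_maximal (Ideal.IsPrime.ne_top ‹_›)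
  have := IsGorensteinRing.isGorensteinLocalRing_localization m
  let B := Localization.AtPrime m
  obtain ⟨d, hd⟩ := IsGorensteinLocalRing.exists_hasInjectiveDimensionLE (R := B)
  have hdisj : Disjoint (m.primeCompl : Set R) p := Set.disjoint_left.2 fun a ha hap ↦ ha (hpm hap)
  let q : Ideal B := p.map (algebraMap R B)
  have hq : q.IsPrime := IsLocalization.isPrime_of_isPrime_disjoint m.primeCompl B p ‹_› hdisj
  have hqp : q.comap (algebraMap R B) = p :=
    IsLocalization.under_map_of_isPrime_disjoint m.primeCompl B ‹_› hdisj
  let T := Localization.AtPrime q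
  have hT : IsLocalization.AtPrime T (q.comap (algebraMap R B)) :=
    IsLocalization.isLocalization_isLocalization_atPrime_isLocalization m.primeCompl T q
  have hT' : IsLocalization p.primeCompl T := by
    simp only [hqp] at hT
    exact hT
  let e : T ≃+* Localization.AtPrime p :=
    (IsLocalization.algEquiv p.primeCompl T (Localization.AtPrime p)).toRingEquiv
  exact ⟨d, (ModuleCat.hasInjectiveDimensionLE_iff_of_semiLinearEquiv e
    (M := ModuleCat.of T T)
    (N := ModuleCat.of (Localization.AtPrime p) (Localization.AtPrime p))
    e.toSemilinearEquiv d).1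
      (hasInjectiveDimensionLE_localization q.primeCompl hd (LinearEquiv.refl B B))⟩

end LocalizationGorenstein

/-! ### Localization of duals and biduals -/

section LocalizedDual

open Module

variable {R : Type*} [CommRing R] (S : Submonoid R)
  (A : Type*) [CommRing A] [Algebra R A] [IsLocalization S A]
  {N : Type*} [AddCommGroup N] [Module R N]
  {N' : Type*} [AddCommGroup N'] [Module R N'] [Module A N'] [IsScalarTower R A N']
  (k : N →ₗ[R] N') [IsLocalizedModule S k]

/-- The localization map `N* → (S⁻¹N)*` on duals. -/
noncomputable def localizedDual : Dual R N →ₗ[R] Dual A N' :=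
  IsLocalizedModule.mapExtendScalars S k (Algebra.linearMap R A) A

lemma localizedDual_apply (f : Dual R N) (n : N) :
    localizedDual S A k f (k n) = algebraMap R A (f n) := by
  simp [localizedDual]

variable [IsNoetherianRing R] [Module.Finite R N]

instance : IsLocalizedModule S (localizedDual S A k) :=
  have := Module.finitePresentation_of_finite R N
  Module.FinitePresentation.isLocalizedModule_mapExtendScalars S k (Algebra.linearMap R A) A

/-- The localization map `N** → (S⁻¹N)**` on biduals. -/
noncomputable def localizedBidual : Dual R (Dual R N) →ₗ[R] Dual A (Dual A N') :=
  localizedDual S A (localizedDual S A k)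

instance : IsLocalizedModule S (localizedBidual S A k) :=
  inferInstanceAs (IsLocalizedModule S (localizedDual S A (localizedDual S A k)))

lemma localizedBidual_eval (n : N) :
    localizedBidual S A k (Dual.eval R N n) = Dual.eval A N' (k n) := by
  have h : (localizedBidual S A k (Dual.eval R N n)).restrictScalars R =
      (Dual.eval A N' (k n)).restrictScalars R := by
    refine IsLocalizedModule.ext S (localizedDual S A k)
      (IsLocalizedModule.map_units (Algebra.linearMap R A)) (LinearMap.ext fun f ↦ ?_)
    simp [localizedBidual, localizedDual_apply]
  exact LinearMap.ext fun φ ↦ LinearMap.congr_fun h φ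

lemma injective_eval_of_isLocalizedModule (k : N →ₗ[R] N') [IsLocalizedModule S k]
    (h : Function.Injective (Dual.eval R N)) : Function.Injective (Dual.eval A N') := by
  rw [injective_iff_map_eq_zero]
  intro n' hn'
  obtain ⟨⟨n, s⟩, hs⟩ := IsLocalizedModule.surj S k n'
  have h0 : localizedBidual S A k (Dual.eval R N n) = localizedBidual S A k 0 := by
    rw [localizedBidual_eval, ← hs, Submonoid.smul_def, ← algebraMap_smul A, map_smul, hn',
      smul_zero, map_zero]
  obtain ⟨t, ht⟩ := IsLocalizedModule.exists_of_eq (S := S) h0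
  have htn : t • n = 0 := h (by simpa using ht)
  refine IsLocalizedModule.smul_injective k (t * s) ?_
  change (t * s) • n' = (t * s) • 0
  rw [mul_smul, hs, smul_zero, Submonoid.smul_def, ← map_smul, ← Submonoid.smul_def, htn, map_zero]

end LocalizedDual

/-! ### A depth criterion for reflexivity -/

section Criterion

open Module IsLocalRing

variable {R : Type u} [CommRing R]

lemma smul_mem_of_forall_algebraMap_smul_mem (p : Ideal R) [p.IsPrime] {N' : Type*}
    [AddCommGroup N'] [Module (Localization.AtPrime p) N']
    (W : Submodule (Localization.AtPrime p) N') (n : N')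
    (h : ∀ r ∈ p, algebraMap R (Localization.AtPrime p) r • n ∈ W) :
    ∀ a ∈ maximalIdeal (Localization.AtPrime p), a • n ∈ W := by
  rw [← Localization.AtPrime.map_eq_maximalIdeal]
  have : p.map (algebraMap R (Localization.AtPrime p)) ≤ W.colon {n} :=
    Ideal.map_le_iff_le_comap.2 fun r hr ↦ Submodule.mem_colon_singleton.2 (h r hr)
  exact fun a ha ↦ Submodule.mem_colon_singleton.1 (this ha)

variable [IsGorensteinRing R] {N : Type*} [AddCommGroup N] [Module R N] [Module.Finite R N]

/-- Over a Gorenstein ring a finitely generated module with `depth N_p ≥ min (1, depth R_p)` for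
all primes `p` is torsionless: the localization at an associated prime of the kernel of biduality
would have a socle element. -/
lemma injective_eval_of_isSocleFree
    (h : ∀ (p : Ideal R) [p.IsPrime], ∀ x ∈ maximalIdeal (Localization.AtPrime p),
      IsSMulRegular (Localization.AtPrime p) x →
      IsSocleFree (Localization.AtPrime p) (LocalizedModule p.primeCompl N)) :
    Function.Injective (Dual.eval R N) := by
  by_contra hne
  rw [← LinearMap.ker_eq_bot, ← ne_eq, ← Submodule.nontrivial_iff_ne_bot] at hne
  obtain ⟨p, hp⟩ := associatedPrimes.nonempty R (LinearMap.ker (Dual.eval R N))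
  obtain ⟨_, n, hpn⟩ := isAssociatedPrime_iff.1 hp
  obtain ⟨d, hd⟩ := IsGorensteinRing.exists_hasInjectiveDimensionLE R p
  let k := LocalizedModule.mkLinearMap p.primeCompl N
  have hk : k n = 0 := by
    refine eq_zero_of_eval_eq_zero_of_socle hd (h p) ?_ ?_
    · rw [← localizedBidual_eval p.primeCompl (Localization.AtPrime p) k, LinearMap.mem_ker.1 n.2,
        map_zero]
    · refine fun a ha ↦ (Submodule.mem_bot (Localization.AtPrime p)).1
        (smul_mem_of_forall_algebraMap_smul_mem p ⊥ _ (fun r hr ↦ ?_) a ha)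
      have hr0 : r • n = 0 := by
        rw [hpn] at hr
        exact (Submodule.mem_bot R).1 (Submodule.mem_colon_singleton.1 hr)
      rw [algebraMap_smul, ← map_smul, ← Submodule.coe_smul, hr0]
      exact map_zero k
  obtain ⟨s, hs⟩ := IsLocalizedModule.exists_of_eq (S := p.primeCompl) (hk.trans (map_zero k).symm)
  refine s.2 (hpn.ge (Submodule.mem_colon_singleton.2 ((Submodule.mem_bot R).2 (Subtype.ext ?_))))
  simpa using! hs

/-- Over a Gorenstein ring, a torsionless finitely generated module with `depth N_p ≥ 2` whenever
`depth R_p ≥ 2` is reflexive: the localization at an associated prime of the cokernel of biduality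
would have a socle element. -/
lemma isReflexive_of_isSocleFreeMod (hinj : Function.Injective (Dual.eval R N))
    (h : ∀ (p : Ideal R) [p.IsPrime], ∀ x ∈ maximalIdeal (Localization.AtPrime p),
      IsSMulRegular (Localization.AtPrime p) x → IsSocleFreeMod x (Localization.AtPrime p) →
      IsSocleFreeMod x (LocalizedModule p.primeCompl N)) :
    Module.IsReflexive R N := by
  refine ⟨hinj, ?_⟩
  by_contra hne
  rw [← LinearMap.range_eq_top, ← ne_eq, ← Submodule.Quotient.nontrivial_iff] at hne
  obtain ⟨p, hp⟩ := associatedPrimes.nonempty R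
    (Dual R (Dual R N) ⧸ LinearMap.range (Dual.eval R N))
  obtain ⟨_, c, hpc⟩ := isAssociatedPrime_iff.1 hp
  obtain ⟨c, rfl⟩ := Submodule.Quotient.mk_surjective _ c
  have hpc' : ∀ r, r ∈ p ↔ r • c ∈ LinearMap.range (Dual.eval R N) := fun r ↦ by
    rw [hpc, Submodule.mem_colon_singleton, Submodule.mem_bot, ← Submodule.Quotient.mk_smul,
      Submodule.Quotient.mk_eq_zero]
  obtain ⟨d, hd⟩ := IsGorensteinRing.exists_hasInjectiveDimensionLE R p
  let A := Localization.AtPrime p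
  let k := LocalizedModule.mkLinearMap p.primeCompl N
  obtain ⟨n', hn'⟩ := mem_range_eval_of_socle hd
    (injective_eval_of_isLocalizedModule p.primeCompl A k hinj) (h p)
    (localizedBidual p.primeCompl A k c) <| by
      refine smul_mem_of_forall_algebraMap_smul_mem p _ _ fun r hr ↦ ?_
      obtain ⟨n, hn⟩ := (hpc' r).1 hr
      exact ⟨k n, by rw [← localizedBidual_eval p.primeCompl, hn, map_smul, algebraMap_smul]⟩
  obtain ⟨⟨n, s⟩, hs⟩ := IsLocalizedModule.surj p.primeCompl k n'
  have h0 : localizedBidual p.primeCompl A k (s • c) =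
      localizedBidual p.primeCompl A k (Dual.eval R N n) := by
    rw [localizedBidual_eval, ← hs, Submonoid.smul_def, Submonoid.smul_def, map_smul,
      ← algebraMap_smul A (s : R) n', map_smul, hn', algebraMap_smul]
  obtain ⟨t, ht⟩ := IsLocalizedModule.exists_of_eq (S := p.primeCompl) h0
  refine (t * s).2 ((hpc' _).2 ⟨t • n, ?_⟩)
  rw [Submonoid.smul_def, map_smul, ← Submonoid.smul_def, ← ht, ← mul_smul]
  rfl

end Criterion

/-! ### Vanishing of `Ext¹` as extendability of maps -/

section ExtOne

open Abelian

/-- If `Ext¹(M, L) = 0`, maps into `L` extend along the inclusion of the syzygy of any finite free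
cover of `M`. -/
lemma exists_extension_of_subsingleton_ext_one {R : Type u} [CommRing R] [Small.{v} R]
    {M L : Type v} [AddCommGroup M] [Module R M] [AddCommGroup L] [Module R L]
    (hext : Subsingleton (Ext (ModuleCat.of R M) (ModuleCat.of R L) 1)) {n : ℕ}
    {π : (Fin n → R) →ₗ[R] M} (hπ : Function.Surjective π) (h : LinearMap.ker π →ₗ[R] L) :
    ∃ h' : (Fin n → R) →ₗ[R] L, h' ∘ₗ (LinearMap.ker π).subtype = h := by
  let e : (Fin n → Shrink.{v} R) ≃ₗ[R] (Fin n → R) :=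
    LinearEquiv.piCongrRight fun _ ↦ Shrink.linearEquiv R R
  let π' : (Fin n → Shrink.{v} R) →ₗ[R] M := π ∘ₗ e.toLinearMap
  have hS := LinearMap.shortExact_shortComplexKer (f := π') (hπ.comp e.surjective)
  let g : LinearMap.ker π' →ₗ[R] L :=
    h ∘ₗ (e.toLinearMap ∘ₗ (LinearMap.ker π').subtype).codRestrict (LinearMap.ker π) fun z ↦ z.2
  obtain ⟨c, hc⟩ := Ext.contravariant_sequence_exact₁ hS (ModuleCat.of R L)
    (Ext.mk₀ (ModuleCat.ofHom g)) (add_zero 1) (hext.elim _ _)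
  obtain ⟨c, rfl⟩ := Ext.homEquiv₀.symm.surjective c
  rw [Ext.homEquiv₀_symm_apply, Ext.mk₀_comp_mk₀] at hc
  have hc' := Ext.homEquiv₀.symm.injective hc
  refine ⟨c.hom ∘ₗ e.symm.toLinearMap, LinearMap.ext fun z ↦ ?_⟩
  have hz : e.symm z ∈ LinearMap.ker π' := by
    simp [π']
  refine (congr($(hc').hom ⟨e.symm z, hz⟩)).trans ?_
  exact congrArg h (Subtype.ext (e.apply_symm_apply z))

end ExtOne

/-! ### Localization of `Hom` and of reflexive modules -/

section Localized

open Module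

variable {R : Type*} [CommRing R] [IsNoetherianRing R] (S : Submonoid R)
  {M L : Type*} [AddCommGroup M] [Module R M] [Module.Finite R M] [AddCommGroup L] [Module R L]

/-- The localization of a reflexive module is a dual module. -/
noncomputable def localizedEquivDual [Module.Finite R L] [Module.IsReflexive R L] (A : Type*)
    [CommRing A] [Algebra R A] [IsLocalization S A] {L' : Type*}
    [AddCommGroup L'] [Module R L'] [Module A L'] [IsScalarTower R A L'] (k : L →ₗ[R] L')
    [IsLocalizedModule S k] {X : Type*} [AddCommGroup X] [Module R X] [Module A X]
    [IsScalarTower R A X] (l : Dual R L →ₗ[R] X) [IsLocalizedModule S l] : L' ≃ₗ[A] Dual A X :=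
  LinearEquiv.extendScalarsOfIsLocalization S A
    (IsLocalizedModule.linearEquiv S k (localizedDual S A l ∘ₗ (evalEquiv R L).toLinearMap))

/-- The localization map `Hom(M, L) → Hom(S⁻¹M, S⁻¹L)`. -/
noncomputable abbrev localizedHom :
    (M →ₗ[R] L) →ₗ[R] (LocalizedModule S M →ₗ[Localization S] LocalizedModule S L) :=
  IsLocalizedModule.mapExtendScalars S (LocalizedModule.mkLinearMap S M)
    (LocalizedModule.mkLinearMap S L) (Localization S)

lemma isLocalizedModule_localizedHom :
    IsLocalizedModule S (localizedHom S (M := M) (L := L)) :=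
  have := Module.finitePresentation_of_finite R M
  Module.FinitePresentation.isLocalizedModule_mapExtendScalars S _ _ _

/-- Extendability of maps `K → L` along `i : K → F` localizes. -/
lemma exists_extension_localizedModule {K F : Type*} [AddCommGroup K] [Module R K]
    [Module.Finite R K] [AddCommGroup F] [Module R F] {i : K →ₗ[R] F}
    (hext : ∀ h : K →ₗ[R] L, ∃ h' : F →ₗ[R] L, h' ∘ₗ i = h)
    (h : LocalizedModule S K →ₗ[Localization S] LocalizedModule S L) :
    ∃ h' : LocalizedModule S F →ₗ[Localization S] LocalizedModule S L,
      h' ∘ₗ localizedHom S i = h := by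
  have := isLocalizedModule_localizedHom S (M := K) (L := L)
  obtain ⟨⟨h₀, s⟩, hs⟩ := IsLocalizedModule.surj S (localizedHom S (M := K) (L := L)) h
  obtain ⟨h₁, rfl⟩ := hext h₀
  obtain ⟨u, hu⟩ := IsLocalization.map_units (Localization S) s
  have hcomp : localizedHom S h₁ ∘ₗ localizedHom S i = localizedHom S (h₁ ∘ₗ i) := by
    refine LinearMap.ext fun z ↦ ?_
    simp [IsLocalizedModule.map_comp' S _ (LocalizedModule.mkLinearMap S F)]
  -- `h` is the localization of `h₁ ∘ i` divided by `s`.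
  refine ⟨(↑u⁻¹ : Localization S) • localizedHom S h₁, ?_⟩
  rw [LinearMap.smul_comp, hcomp, ← hs, Submonoid.smul_def,
    ← algebraMap_smul (Localization S) (s : R) h, ← hu, smul_smul, Units.inv_mul, one_smul]

end Localized

/-! ### Reflexivity of a module and of its endomorphisms -/

section Main

open Module IsLocalRing

variable {R : Type u} [CommRing R] [IsGorensteinRing R]
    {M : Type v} [AddCommGroup M] [Module R M] [Module.Finite R M]

/-- Locally `M` is a dual, and both depth conditions pass from a dual to `Hom(-, M)`. -/
lemma isReflexive_end_of_isReflexive (hM : Module.IsReflexive R M) :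
    Module.IsReflexive R (M →ₗ[R] M) := by
  let e (p : Ideal R) [p.IsPrime] :=
    have := isLocalizedModule_localizedHom p.primeCompl (M := M) (L := M)
    LinearEquiv.extendScalarsOfIsLocalization p.primeCompl (Localization.AtPrime p)
      (IsLocalizedModule.linearEquiv p.primeCompl (localizedHom p.primeCompl)
        (LocalizedModule.mkLinearMap p.primeCompl (M →ₗ[R] M)))
  let e' (p : Ideal R) [p.IsPrime] :=
    localizedEquivDual p.primeCompl (Localization.AtPrime p)
      (LocalizedModule.mkLinearMap p.primeCompl M)
      (X := LocalizedModule p.primeCompl (Dual R M)) (LocalizedModule.mkLinearMap p.primeCompl _)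
  have hreg : ∀ (p : Ideal R) [p.IsPrime] (x : Localization.AtPrime p),
      IsSMulRegular (Localization.AtPrime p) x →
      IsSMulRegular (LocalizedModule p.primeCompl M) x := fun p _ x hx ↦
    ((e' p).isSMulRegular_congr x).2 (hx.linearMap (N := LocalizedModule p.primeCompl (Dual R M)))
  refine isReflexive_of_isSocleFreeMod (injective_eval_of_isSocleFree fun p _ x hxm hx ↦ ?_)
    fun p _ x hxm hx h ↦ ?_
  · exact .of_isSMulRegular hxm (((e p).isSMulRegular_congr x).1 (hreg p x hx).linearMap)
  · exact .of_equiv (e p) (.linearMap (hreg p x hx) (.of_equiv (e' p).symm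
      (.linearMap (N := LocalizedModule p.primeCompl (Dual R M)) hx h)))

/-- Locally `End M` is a dual, so it satisfies the depth conditions. A socle element of `M` or of
`M ⧸ xM` is the image of a map factoring through the residue field; `Ext¹(M, M) = 0` lifts the
latter map to `End M`, and this moves the socle element to `End M` or `End M ⧸ x End M`. -/
lemma isReflexive_of_isReflexive_end [Small.{v} R]
    (hext : Subsingleton (Abelian.Ext (ModuleCat.of R M) (ModuleCat.of R M) 1))
    (hM : Module.IsReflexive R (M →ₗ[R] M)) : Module.IsReflexive R M := by
  let e (p : Ideal R) [p.IsPrime] :=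
    have := isLocalizedModule_localizedHom p.primeCompl (M := M) (L := M)
    localizedEquivDual p.primeCompl (Localization.AtPrime p)
      (localizedHom p.primeCompl (M := M) (L := M))
      (X := LocalizedModule p.primeCompl (Dual R (M →ₗ[R] M)))
      (LocalizedModule.mkLinearMap p.primeCompl _)
  have hinj : Function.Injective (Dual.eval R M) :=
    injective_eval_of_isSocleFree fun p _ x hxm hx ↦
      .of_end (.of_isSMulRegular hxm (((e p).isSMulRegular_congr x).2
        (hx.linearMap (N := LocalizedModule p.primeCompl (Dual R (M →ₗ[R] M))))))
  refine isReflexive_of_isSocleFreeMod hinj fun p _ x hxm hx h ↦ ?_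
  have hxM : IsSMulRegular (LocalizedModule p.primeCompl M) x :=
    hx.of_injective_eval (injective_eval_of_isLocalizedModule p.primeCompl _
      (LocalizedModule.mkLinearMap p.primeCompl M) hinj)
  obtain ⟨n, π, hπ⟩ := Module.Finite.exists_fin' R M
  refine .of_end hxM (fun g ↦ ?_) (.of_equiv (e p).symm
    (.linearMap (N := LocalizedModule p.primeCompl (Dual R (M →ₗ[R] M))) hx h))
  exact exists_lift_of_forall_exists_extension
    (i := localizedHom p.primeCompl (LinearMap.ker π).subtype)
    (π := localizedHom p.primeCompl π)
    (IsLocalizedModule.map_surjective p.primeCompl _ _ π hπ)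
    (IsLocalizedModule.map_exact p.primeCompl _ _ _ _ _ (LinearMap.exact_subtype_ker_map π))
    (exists_extension_localizedModule p.primeCompl
      (exists_extension_of_subsingleton_ext_one hext hπ)) hxM g

end Main

theorem mainTheorem6 (R : Type u) [CommRing R] [IsGorensteinRing R] [Small.{v} R]
    (M : Type v) [AddCommGroup M] [Module R M] [Module.Finite R M] :
    (Subsingleton (Abelian.Ext (ModuleCat.of R M) (ModuleCat.of R M) 1) →
      Module.IsReflexive R (M →ₗ[R] M) → Module.IsReflexive R M) ∧
    (Module.IsReflexive R M → Module.IsReflexive R (M →ₗ[R] M)) :=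
  ⟨isReflexive_of_isReflexive_end, isReflexive_end_of_isReflexive⟩
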